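/- Let $G$ be a finite simple graph. For $X \subseteq V(G)$ let $N_G[X]$ be the set of vertices that lie in $X$ or are adjacent to a vertex of $X$; a vertex dominates itself and its neighbours. In the isolation game on $G$, two players, Dominator and Staller, alternately play a vertex of $G$. If $X$ is the set of vertices played so far, a vertex may be played if and only if it dominates some vertex belonging to a connected component with at least two vertices of the graph $G - N_G[X]$. The game ends when no vertex may be played. Dominator wants to minimize, and Staller to maximize, the total number of moves. Let $\iota_{\rm g}(G)$ (the game isolation number) and $\iota_{\rm g}'(G)$ (the Staller-start game isolation number) be the number of moves made under optimal play of both players when Dominator, respectively Staller, makes the first move. Let $C_n$ denote the cycle on $n$ vertices. **Theorem.** For every integer $n \ge 4$, $$\iota_{\rm g}(C_n) = \begin{cases} 2\left\lceil \frac{n}{5}\right\rceil & \text{if } n \equiv 0 \pmod 5,\\ 2\left\lceil \frac{n}{5}\right\rceil - 1 & \text{otherwise,}\end{cases} \qquad \iota_{\rm g}'(C_n) = \begin{cases} 2\left\lfloor \frac{n}{5}\right\rfloor + 1 & \text{if } n \equiv 4 \pmod 5,\\ 2\left\lfloor \frac{n}{5}\right\rfloor & \text{otherwise.}\end{cases}$$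 -/

import Mathlib

namespace IsolationGame

/-- The two players of the isolation game. -/
inductive Player
  | dominator
  | staller

variable {V : Type*}

/-- The closed neighbourhood `N_G[X]`: the vertices that are in `X` or adjacent to a vertex of `X`. -/
def closedNbhd (G : SimpleGraph V) (X : Set V) : Set V :=
  {w | ∃ x ∈ X, w = x ∨ G.Adj x w}

/-- `w` is a vertex of the graph `G - N_G[X]`, and the connected component of `G - N_G[X]` that
contains `w` is nontrivial, that is, has at least two vertices. -/
def InNontrivialComponent (G : SimpleGraph V) (X : Set V) (w : V) : Prop :=
  ∃ hw : w ∈ (closedNbhd G X)ᶜ,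
    ((G.induce (closedNbhd G X)ᶜ).connectedComponentMk ⟨w, hw⟩).supp.Nontrivial

/-- When `X` is the set of already played vertices, `v` may be played if and only if it dominates
(is equal or adjacent to) some vertex of a nontrivial component of `G - N_G[X]`. -/
def Playable (G : SimpleGraph V) (X : Set V) (v : V) : Prop :=
  ∃ w ∈ closedNbhd G {v}, InNontrivialComponent G X w

theorem Playable.notMem {G : SimpleGraph V} {X : Set V} {v : V} (h : Playable G X v) : v ∉ X := by
  intro hv
  obtain ⟨w, ⟨x, rfl, hw⟩, hw', -⟩ := h
  exact hw' ⟨x, hv, hw⟩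

open Classical in
/-- The set of legal moves when `X` is the set of already played vertices. -/
noncomputable def legalMoves [Fintype V] (G : SimpleGraph V) (X : Finset V) : Finset V :=
  Finset.univ.filter fun v => Playable G (X : Set V) v

theorem card_compl_insert_lt [Fintype V] [DecidableEq V] {G : SimpleGraph V} {X : Finset V} {v : V}
    (h : v ∈ legalMoves G X) : ((insert v X)ᶜ : Finset V).card < (Xᶜ : Finset V).card := by
  have hv : v ∉ X := by
    classical
    simpa using Playable.notMem (Finset.mem_filter.mp h).2
  apply Finset.card_lt_card
  rw [Finset.compl_ssubset_compl]
  exact Finset.ssubset_insert hv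

open Classical in
/-- The number of moves still to be made under optimal play, when `X` is the set of already played
vertices and the given player is to move. The game is over when there is no legal move; otherwise
the player to move must make a legal move, Dominator minimizing and Staller maximizing the
number of moves. -/
noncomputable def movesLeft [Fintype V] (G : SimpleGraph V) : Player → Finset V → ℕ
  | .dominator, X =>
    if h : (legalMoves G X).Nonempty then
      1 + (legalMoves G X).attach.inf' (Finset.attach_nonempty_iff.mpr h)
        fun v => movesLeft G .staller (insert v.1 X)
    else 0
  | .staller, X =>
    if h : (legalMoves G X).Nonempty then
      1 + (legalMoves G X).attach.sup' (Finset.attach_nonempty_iff.mpr h)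
        fun v => movesLeft G .dominator (insert v.1 X)
    else 0
termination_by _ X => (Xᶜ : Finset V).card
decreasing_by
  all_goals exact card_compl_insert_lt v.2

/-- The game isolation number (Dominator makes the first move). -/
noncomputable def gameIsolationNumber [Fintype V] (G : SimpleGraph V) : ℕ :=
  movesLeft G .dominator ∅

/-- The Staller-start game isolation number (Staller makes the first move). -/
noncomputable def stallerStartGameIsolationNumber [Fintype V] (G : SimpleGraph V) : ℕ :=
  movesLeft G .staller ∅

end IsolationGame

/-!
Once a vertex of the cycle has been played, the undominated vertices form runs of consecutive
vertices. A move deletes three consecutive vertices of a run of length at least two, or one or two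
vertices at one of its ends, so only the multiset of run lengths matters. Both bounds come from
additive potentials that grow by two for every five vertices of a run: Dominator cuts a run of
length `r` into runs of lengths `1` and `r - 4`, wasting one vertex, while Staller shortens a run by
a single vertex. For a single run the two bounds agree, and every first move on the `n`-cycle leaves
a single run of length `n - 3`.
-/

namespace IsolationGame

variable {V : Type*} {G : SimpleGraph V}

theorem inNontrivialComponent_iff {X : Set V} {w : V} :
    InNontrivialComponent G X w ↔ w ∉ closedNbhd G X ∧ ∃ u ∉ closedNbhd G X, G.Adj w u := by
  constructor
  · rintro ⟨hw, hnontrivial⟩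
    obtain ⟨y, hy, hne⟩ := hnontrivial.exists_ne ⟨w, hw⟩
    obtain ⟨walk⟩ := (SimpleGraph.ConnectedComponent.exact hy).symm
    cases walk with
    | nil => exact absurd rfl hne
    | cons hadj _ => exact ⟨hw, _, Subtype.property (p := (· ∈ (closedNbhd G X)ᶜ)) _, hadj⟩
  · rintro ⟨hw, u, hu, hadj⟩
    have hadj' : (G.induce (closedNbhd G X)ᶜ).Adj ⟨w, hw⟩ ⟨u, hu⟩ := hadj
    exact ⟨hw, ⟨w, hw⟩, rfl, ⟨u, hu⟩,
      SimpleGraph.ConnectedComponent.sound hadj'.symm.reachable, hadj'.ne⟩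

theorem mem_closedNbhd_singleton {v w : V} : w ∈ closedNbhd G {v} ↔ w = v ∨ G.Adj v w := by
  simp [closedNbhd]

theorem closedNbhd_insert (X : Set V) (v : V) :
    closedNbhd G (insert v X) = closedNbhd G {v} ∪ closedNbhd G X := by
  ext
  simp [closedNbhd]

section Moves

variable [Fintype V] {X : Finset V}

theorem mem_legalMoves {v : V} : v ∈ legalMoves G X ↔ Playable G (X : Set V) v := by
  simp [legalMoves]

theorem movesLeft_eq_zero (h : ¬ (legalMoves G X).Nonempty) (P : Player) :
    movesLeft G P X = 0 := by
  cases P <;> rw [movesLeft, dif_neg h]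

variable [DecidableEq V]

theorem movesLeft_dominator_eq_inf' (h : (legalMoves G X).Nonempty) :
    movesLeft G .dominator X = (legalMoves G X).attach.inf' (Finset.attach_nonempty_iff.mpr h)
      (fun v ↦ movesLeft G .staller (insert v.1 X)) + 1 := by
  rw [movesLeft.eq_1, dif_pos h, add_comm]
  congr!

theorem movesLeft_staller_eq_sup' (h : (legalMoves G X).Nonempty) :
    movesLeft G .staller X = (legalMoves G X).attach.sup' (Finset.attach_nonempty_iff.mpr h)
      (fun v ↦ movesLeft G .dominator (insert v.1 X)) + 1 := by
  rw [movesLeft.eq_2, dif_pos h, add_comm]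
  congr!

theorem movesLeft_dominator_le {v : V} (hv : v ∈ legalMoves G X) :
    movesLeft G .dominator X ≤ movesLeft G .staller (insert v X) + 1 := by
  rw [movesLeft_dominator_eq_inf' ⟨v, hv⟩]
  exact Nat.add_le_add_right (Finset.inf'_le _ (Finset.mem_attach _ ⟨v, hv⟩)) 1

theorem exists_movesLeft_dominator_eq (h : (legalMoves G X).Nonempty) :
    ∃ v ∈ legalMoves G X,
      movesLeft G .dominator X = movesLeft G .staller (insert v X) + 1 := by
  rw [movesLeft_dominator_eq_inf' h]
  obtain ⟨v, -, hv⟩ := Finset.exists_mem_eq_inf' (Finset.attach_nonempty_iff.mpr h)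
    fun v ↦ movesLeft G .staller (insert v.1 X)
  exact ⟨v, v.2, congrArg (· + 1) hv⟩

theorem le_movesLeft_staller {v : V} (hv : v ∈ legalMoves G X) :
    movesLeft G .dominator (insert v X) + 1 ≤ movesLeft G .staller X := by
  rw [movesLeft_staller_eq_sup' ⟨v, hv⟩]
  exact Nat.add_le_add_right (Finset.le_sup' (fun v : legalMoves G X ↦
    movesLeft G .dominator (insert v.1 X)) (Finset.mem_attach _ ⟨v, hv⟩)) 1

theorem exists_movesLeft_staller_eq (h : (legalMoves G X).Nonempty) :
    ∃ v ∈ legalMoves G X,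
      movesLeft G .staller X = movesLeft G .dominator (insert v X) + 1 := by
  rw [movesLeft_staller_eq_sup' h]
  obtain ⟨v, -, hv⟩ := Finset.exists_mem_eq_sup' (Finset.attach_nonempty_iff.mpr h)
    fun v ↦ movesLeft G .dominator (insert v.1 X)
  exact ⟨v, v.2, congrArg (· + 1) hv⟩

@[elab_as_elim]
theorem legalMoves_induction {motive : Finset V → Prop} (X : Finset V)
    (step : ∀ X, (∀ v ∈ legalMoves G X, motive (insert v X)) → motive X) : motive X := by
  induction h : (Xᶜ).card using Nat.strong_induction_on generalizing X with
  | _ c ih =>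
    subst h
    exact step X fun v hv ↦ ih _ (card_compl_insert_lt hv) _ rfl

end Moves

section RunGame

/-- A move in a run of `r ≥ 2` consecutive undominated vertices leaves runs of lengths `a` and `b`:
it dominates three consecutive vertices of the run, or one or two vertices at one of its ends. -/
def RunSplit (r a b : ℕ) : Prop :=
  2 ≤ r ∧ a + b < r ∧ r ≤ a + b + 3 ∧ (r = a + b + 3 ∨ a = 0 ∨ b = 0)

/-- A move of the game on multisets of run lengths, which forgets everything about a position of
the isolation game except the lengths of its runs. Runs of length `0` and `1` are dead. -/
def RunMove (s s' : Multiset ℕ) : Prop :=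
  ∃ t r a b, RunSplit r a b ∧ s = r ::ₘ t ∧ s' = a ::ₘ b ::ₘ t

theorem RunSplit.runMove {r a b : ℕ} (h : RunSplit r a b) (t : Multiset ℕ) :
    RunMove (r ::ₘ t) (a ::ₘ b ::ₘ t) :=
  ⟨t, r, a, b, h, rfl, rfl⟩

theorem runSplit_pred {r : ℕ} (hr : 2 ≤ r) : RunSplit r 0 (r - 1) := by
  unfold RunSplit
  omega

theorem runSplit_one {r : ℕ} (hr : 2 ≤ r) : RunSplit r 1 (r - 4) := by
  unfold RunSplit
  omega

/-- Dominator's potential of a run of length `r`. -/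
def runUpperWeight (r : ℕ) : ℕ := (r + 2) / 5 + (r + 3) / 5

/-- Dominator's potential: with Staller to move, the number of moves left is at most this. -/
def upperWeight (s : Multiset ℕ) : ℕ := (s.map runUpperWeight).sum

/-- Some move lowers Dominator's potential by two, so Dominator on the move gains one. -/
def Reducible (s : Multiset ℕ) : Prop := ∃ s', RunMove s s' ∧ upperWeight s' + 2 ≤ upperWeight s

/-- Four times Staller's potential of a run of length `r`; the truncated subtraction matters only
for `r = 0`. -/
def runLowerWeight (r : ℕ) : ℕ := r + 3 * ((r + 3) / 5) - 1

/-- Four times Staller's potential: with Staller to move, four times the number of moves left is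
at least this. -/
def lowerWeight (s : Multiset ℕ) : ℕ := (s.map runLowerWeight).sum

@[simp]
theorem upperWeight_cons (r : ℕ) (s : Multiset ℕ) :
    upperWeight (r ::ₘ s) = runUpperWeight r + upperWeight s := by
  simp [upperWeight]

@[simp]
theorem lowerWeight_cons (r : ℕ) (s : Multiset ℕ) :
    lowerWeight (r ::ₘ s) = runLowerWeight r + lowerWeight s := by
  simp [lowerWeight]

theorem runUpperWeight_sub_four {r : ℕ} (hr : 3 ≤ r) :
    runUpperWeight (r - 4) + 2 = runUpperWeight (r + 1) := by
  unfold runUpperWeight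
  omega

theorem reducible_cons {r : ℕ} (hr : 3 ≤ r) (h : runUpperWeight (r + 1) = runUpperWeight r)
    (t : Multiset ℕ) : Reducible (r ::ₘ t) := by
  refine ⟨_, (runSplit_one (by omega)).runMove t, ?_⟩
  have hsub := runUpperWeight_sub_four hr
  have hone : runUpperWeight 1 = 0 := rfl
  simp only [upperWeight_cons]
  omega

theorem RunMove.exists_upperWeight_lt {s s' : Multiset ℕ} (h : RunMove s s') :
    ∃ s'', RunMove s s'' ∧ upperWeight s'' < upperWeight s := by
  obtain ⟨t, r, -, -, ⟨hr, -⟩, rfl, -⟩ := h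
  refine ⟨_, (runSplit_one hr).runMove t, ?_⟩
  simp only [upperWeight_cons, runUpperWeight]
  omega

theorem RunSplit.runUpperWeight_lt_or {r a b : ℕ} (h : RunSplit r a b) :
    runUpperWeight a + runUpperWeight b < runUpperWeight r ∨
      runUpperWeight a + runUpperWeight b ≤ runUpperWeight r ∧
        (3 ≤ a ∧ runUpperWeight (a + 1) = runUpperWeight a ∨
          3 ≤ b ∧ runUpperWeight (b + 1) = runUpperWeight b) := by
  unfold RunSplit at h
  unfold runUpperWeight
  omega

theorem RunMove.upperWeight_lt_or {s s' : Multiset ℕ} (h : RunMove s s') :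
    upperWeight s' < upperWeight s ∨ upperWeight s' ≤ upperWeight s ∧ Reducible s' := by
  obtain ⟨t, r, a, b, hsplit, rfl, rfl⟩ := h
  simp only [upperWeight_cons, ← add_assoc, add_lt_add_iff_right, add_le_add_iff_right]
  refine hsplit.runUpperWeight_lt_or.imp_right fun ⟨hle, hflat⟩ ↦ ⟨hle, ?_⟩
  rcases hflat with ⟨ha, hflat⟩ | ⟨hb, hflat⟩
  · exact reducible_cons ha hflat _
  · rw [Multiset.cons_swap]
    exact reducible_cons hb hflat _

theorem RunSplit.runLowerWeight_le {r a b : ℕ} (h : RunSplit r a b) :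
    runLowerWeight r ≤ runLowerWeight a + runLowerWeight b + 7 := by
  unfold RunSplit at h
  unfold runLowerWeight
  omega

theorem RunMove.lowerWeight_le {s s' : Multiset ℕ} (h : RunMove s s') :
    lowerWeight s ≤ lowerWeight s' + 7 := by
  obtain ⟨t, r, a, b, hsplit, rfl, rfl⟩ := h
  have hle := hsplit.runLowerWeight_le
  simp only [lowerWeight_cons]
  omega

theorem runLowerWeight_pred {r : ℕ} (hr : r % 5 ≠ 2) :
    runLowerWeight r ≤ runLowerWeight (r - 1) + 1 := by
  unfold runLowerWeight
  omega

theorem runLowerWeight_le_pred_add_four (r : ℕ) :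
    runLowerWeight r ≤ runLowerWeight (r - 1) + 4 := by
  unfold runLowerWeight
  omega

theorem four_dvd_runLowerWeight {r : ℕ} (h : 2 ≤ r → r % 5 = 2) : 4 ∣ runLowerWeight r := by
  unfold runLowerWeight
  omega

theorem exists_runMove_runLowerWeight {s : Multiset ℕ} {r : ℕ} (hr : 2 ≤ r) (hmem : r ∈ s) :
    ∃ s', RunMove s s' ∧ lowerWeight s + runLowerWeight (r - 1) =
      lowerWeight s' + runLowerWeight r := by
  obtain ⟨t, rfl⟩ := Multiset.exists_cons_of_mem hmem
  refine ⟨_, (runSplit_pred hr).runMove t, ?_⟩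
  have hzero : runLowerWeight 0 = 0 := rfl
  simp only [lowerWeight_cons]
  omega

/-- When every live run has length `2` modulo `5`, shortening one costs Staller a full move, but
then divisibility by four makes up for the rounding loss in Dominator's next move. -/
theorem RunMove.exists_lowerWeight_le {s s' : Multiset ℕ} (h : RunMove s s') :
    ∃ s'', RunMove s s'' ∧ (lowerWeight s ≤ lowerWeight s'' + 1 ∨
      4 ∣ lowerWeight s ∧ lowerWeight s ≤ lowerWeight s'' + 4) := by
  by_cases hgood : ∃ r ∈ s, 2 ≤ r ∧ r % 5 ≠ 2
  · obtain ⟨r, hmem, hr, hmod⟩ := hgood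
    obtain ⟨s'', hmove, hweight⟩ := exists_runMove_runLowerWeight hr hmem
    have hpred := runLowerWeight_pred hmod
    exact ⟨s'', hmove, by omega⟩
  · push Not at hgood
    have hdvd : 4 ∣ lowerWeight s :=
      Multiset.dvd_sum <| Multiset.forall_mem_map_iff.mpr
        fun r hmem ↦ four_dvd_runLowerWeight (hgood r hmem)
    obtain ⟨t, r, -, -, ⟨hr, -⟩, rfl, -⟩ := h
    obtain ⟨s'', hmove, hweight⟩ := exists_runMove_runLowerWeight hr (Multiset.mem_cons_self r t)
    have hpred := runLowerWeight_le_pred_add_four r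
    exact ⟨s'', hmove, by omega⟩

theorem lowerWeight_eq_zero {s : Multiset ℕ} (h : ∀ s', ¬ RunMove s s') : lowerWeight s = 0 := by
  refine Multiset.sum_eq_zero <| Multiset.forall_mem_map_iff.mpr fun r hmem ↦ ?_
  have hr : r < 2 := by
    by_contra! hr
    obtain ⟨s', hmove, -⟩ := exists_runMove_runLowerWeight hr hmem
    exact h s' hmove
  unfold runLowerWeight
  omega

end RunGame

/-- The relation `R` between positions and multisets of run lengths is a bisimulation between the
isolation game on `G` and the game with moves `RunMove`. -/
structure IsRunModel [Fintype V] [DecidableEq V] (G : SimpleGraph V)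
    (R : Finset V → Multiset ℕ → Prop) : Prop where
  exists_runMove : ∀ {X s v}, R X s → v ∈ legalMoves G X → ∃ s', RunMove s s' ∧ R (insert v X) s'
  exists_legalMove : ∀ {X s s'}, R X s → RunMove s s' → ∃ v ∈ legalMoves G X, R (insert v X) s'

namespace IsRunModel

variable [Fintype V] [DecidableEq V] {R : Finset V → Multiset ℕ → Prop} {X : Finset V}
  {s : Multiset ℕ} {r : ℕ}

theorem movesLeft_le_upperWeight (hR : IsRunModel G R) (h : R X s) :
    movesLeft G .staller X ≤ upperWeight s ∧ movesLeft G .dominator X ≤ upperWeight s ∧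
      (Reducible s → movesLeft G .dominator X + 1 ≤ upperWeight s) := by
  induction X using legalMoves_induction (G := G) generalizing s with
  | step X ih =>
    have hdominator {s'} (hmove : RunMove s s') :
        movesLeft G .dominator X ≤ upperWeight s' + 1 := by
      obtain ⟨v, hv, h'⟩ := hR.exists_legalMove h hmove
      exact (movesLeft_dominator_le hv).trans (Nat.add_le_add_right (ih v hv h').1 1)
    refine ⟨?_, ?_, fun ⟨s', hmove, hweight⟩ ↦ ?_⟩
    · by_cases hne : (legalMoves G X).Nonempty
      · obtain ⟨v, hv, hopt⟩ := exists_movesLeft_staller_eq hne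
        obtain ⟨s', hmove, h'⟩ := hR.exists_runMove h hv
        obtain ⟨-, hle, hred⟩ := ih v hv h'
        rcases hmove.upperWeight_lt_or with hlt | ⟨hweight, hred'⟩
        · omega
        · have hgain := hred hred'
          omega
      · simp [movesLeft_eq_zero hne]
    · by_cases hne : (legalMoves G X).Nonempty
      · obtain ⟨v, hv⟩ := hne
        obtain ⟨s', hmove, -⟩ := hR.exists_runMove h hv
        obtain ⟨s'', hmove', hlt⟩ := hmove.exists_upperWeight_lt
        exact (hdominator hmove').trans hlt
      · simp [movesLeft_eq_zero hne]
    · have hle := hdominator hmove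
      omega

theorem lowerWeight_le_movesLeft (hR : IsRunModel G R) (h : R X s) :
    lowerWeight s ≤ 4 * movesLeft G .staller X ∧
      lowerWeight s ≤ 4 * movesLeft G .dominator X + 3 := by
  induction X using legalMoves_induction (G := G) generalizing s with
  | step X ih =>
    by_cases hne : (legalMoves G X).Nonempty
    · constructor
      · obtain ⟨v, hv⟩ := hne
        obtain ⟨s', hmove, -⟩ := hR.exists_runMove h hv
        obtain ⟨s'', hmove', hweight⟩ := hmove.exists_lowerWeight_le
        obtain ⟨w, hw, h'⟩ := hR.exists_legalMove h hmove'
        have hle := (ih w hw h').2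
        have hstaller := le_movesLeft_staller hw
        omega
      · obtain ⟨v, hv, hopt⟩ := exists_movesLeft_dominator_eq hne
        obtain ⟨s', hmove, h'⟩ := hR.exists_runMove h hv
        have hle := (ih v hv h').1
        have hweight := hmove.lowerWeight_le
        omega
    · have hzero : lowerWeight s = 0 := lowerWeight_eq_zero fun s' hmove ↦
        let ⟨v, hv, _⟩ := hR.exists_legalMove h hmove
        hne ⟨v, hv⟩
      simp [hzero]

theorem movesLeft_staller_singleton (hR : IsRunModel G R) (h : R X {r}) :
    movesLeft G .staller X = (r + 2) / 5 + (r + 3) / 5 := by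
  have hupper := (hR.movesLeft_le_upperWeight h).1
  have hlower := (hR.lowerWeight_le_movesLeft h).1
  simp only [upperWeight, lowerWeight, Multiset.map_singleton, Multiset.sum_singleton,
    runUpperWeight, runLowerWeight] at hupper hlower
  omega

theorem movesLeft_dominator_singleton (hR : IsRunModel G R) (h : R X {r}) :
    movesLeft G .dominator X = (r + 3) / 5 + (r + 4) / 5 - 1 := by
  obtain ⟨-, hupper, hred⟩ := hR.movesLeft_le_upperWeight h
  have hlower := (hR.lowerWeight_le_movesLeft h).2
  replace hred := fun hr hflat ↦ hred (reducible_cons (r := r) hr hflat 0)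
  simp only [upperWeight, lowerWeight, Multiset.map_singleton, Multiset.sum_singleton,
    runUpperWeight, runLowerWeight] at hupper hlower hred
  omega

end IsRunModel

section Cycle

open SimpleGraph

variable {n : ℕ} {o : Fin n} {X : Finset (Fin n)} {l l' : List (ℕ × ℕ)} {p : ℕ × ℕ}

/-- The number of steps from the vertex `o` to the vertex `x` around the cycle. -/
def offset (o x : Fin n) : ℕ := (x - o).val

theorem offset_lt (o x : Fin n) : offset o x < n := (x - o).isLt

theorem offset_self (o : Fin n) : offset o o = 0 := by
  have : NeZero n := ⟨o.pos.ne'⟩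
  simp [offset]

theorem exists_offset_eq (o : Fin n) {i : ℕ} (hi : i < n) : ∃ x, offset o x = i := by
  have : NeZero n := ⟨o.pos.ne'⟩
  exact ⟨⟨i, hi⟩ + o, by simp [offset]⟩

theorem offset_inj {x y : Fin n} : offset o x = offset o y ↔ x = y := by
  have : NeZero n := ⟨o.pos.ne'⟩
  rw [offset, offset, Fin.val_inj, sub_left_inj]

theorem cycleGraph_adj_iff_offset (o : Fin n) {x y : Fin n} (hn : 2 ≤ n) :
    (cycleGraph n).Adj x y ↔
      offset o x + 1 = offset o y ∨ offset o y + 1 = offset o x ∨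
        offset o x = 0 ∧ offset o y + 1 = n ∨ offset o y = 0 ∧ offset o x + 1 = n := by
  have hxo := Fin.intCast_val_sub_eq_sub_add_ite x o
  have hyo := Fin.intCast_val_sub_eq_sub_add_ite y o
  have hxy := Fin.intCast_val_sub_eq_sub_add_ite x y
  have hyx := Fin.intCast_val_sub_eq_sub_add_ite y x
  simp only [Fin.le_def] at hxo hyo hxy hyx
  simp only [cycleGraph_adj', offset]
  split_ifs at hxo hyo hxy hyx <;> omega

/-- The intervals `[a, b)` and `[c, d)`, in either order, have at least two numbers between them. -/
def Separated (p q : ℕ × ℕ) : Prop := p.2 + 2 ≤ q.1 ∨ q.2 + 2 ≤ p.1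

instance : Std.Symm Separated := ⟨fun _ _ ↦ Or.symm⟩

/-- The vertices not dominated by `X` are those whose offset from `o` lies in one of the intervals
`[a, b)` with `(a, b) ∈ l`. Empty intervals, with `b ≤ a`, are allowed. -/
structure IsRunList (o : Fin n) (X : Finset (Fin n)) (l : List (ℕ × ℕ)) : Prop where
  notMem_closedNbhd_iff : ∀ x, x ∉ closedNbhd (cycleGraph n) (X : Set (Fin n)) ↔
    ∃ p ∈ l, offset o x ∈ Set.Ico p.1 p.2
  bounds : ∀ p ∈ l, 1 ≤ p.1 ∧ p.2 < n
  separated : l.Pairwise Separated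

/-- The lengths of the runs of undominated vertices in the position `X` on the cycle, up to runs of
length `0`, where `o` is a reference vertex. -/
def HasRuns (o : Fin n) (X : Finset (Fin n)) (s : Multiset ℕ) : Prop :=
  ∃ l, IsRunList o X l ∧ s = (l.map fun p ↦ p.2 - p.1 : List ℕ)

namespace IsRunList

theorem perm (h : IsRunList o X l) (hl : l.Perm l') : IsRunList o X l' where
  notMem_closedNbhd_iff x := by simp only [h.notMem_closedNbhd_iff, hl.mem_iff]
  bounds p hp := h.bounds p (hl.mem_iff.mpr hp)
  separated := hl.pairwise h.separated Or.symm

theorem mem_closedNbhd_singleton_iff (h : IsRunList o X l) (hp : p ∈ l) {x v : Fin n}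
    (hx : offset o x ∈ Set.Ico p.1 p.2) :
    x ∈ closedNbhd (cycleGraph n) {v} ↔
      offset o x ≤ offset o v + 1 ∧ offset o v ≤ offset o x + 1 := by
  have hbounds := h.bounds p hp
  rw [Set.mem_Ico] at hx
  rw [mem_closedNbhd_singleton, cycleGraph_adj_iff_offset o (by omega), ← offset_inj (o := o)]
  omega

theorem eq_of_adj (h : IsRunList o X l) {q : ℕ × ℕ} (hp : p ∈ l) (hq : q ∈ l) {x y : Fin n}
    (hx : offset o x ∈ Set.Ico p.1 p.2) (hy : offset o y ∈ Set.Ico q.1 q.2)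
    (hadj : (cycleGraph n).Adj x y) : p = q := by
  by_contra hne
  have hsep := h.separated.forall hp hq hne
  have hnear := (h.mem_closedNbhd_singleton_iff hq hy).mp (mem_closedNbhd_singleton.mpr (.inr hadj))
  rw [Set.mem_Ico] at hx hy
  unfold Separated at hsep
  omega

theorem mem_legalMoves_iff (h : IsRunList o X l) {v : Fin n} :
    v ∈ legalMoves (cycleGraph n) X ↔
      ∃ p ∈ l, p.1 + 2 ≤ p.2 ∧ p.1 ≤ offset o v + 1 ∧ offset o v ≤ p.2 := by
  simp only [mem_legalMoves, Playable, inNontrivialComponent_iff, h.notMem_closedNbhd_iff]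
  constructor
  · rintro ⟨w, hvw, ⟨p, hp, hw⟩, u, ⟨q, hq, hu⟩, hadj⟩
    obtain rfl := h.eq_of_adj hp hq hw hu hadj
    rw [h.mem_closedNbhd_singleton_iff hp hw] at hvw
    have hne := offset_inj (o := o).not.mpr hadj.ne
    rw [Set.mem_Ico] at hw hu
    exact ⟨p, hp, by omega⟩
  · rintro ⟨p, hp, hlen, hleft, hright⟩
    have hbounds := h.bounds p hp
    obtain ⟨i, j, hi, hj, hij, hiv⟩ : ∃ i j, i ∈ Set.Ico p.1 p.2 ∧ j ∈ Set.Ico p.1 p.2 ∧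
        (i + 1 = j ∨ j + 1 = i) ∧ i ≤ offset o v + 1 ∧ offset o v ≤ i + 1 := by
      simp only [Set.mem_Ico]
      by_cases hv : offset o v + 1 < p.2
      · exact ⟨offset o v + 1, if p.1 ≤ offset o v then offset o v else offset o v + 2,
          by split_ifs <;> omega⟩
      · exact ⟨p.2 - 1, p.2 - 2, by omega⟩
    obtain ⟨w, rfl⟩ := exists_offset_eq o (hi.2.trans hbounds.2)
    obtain ⟨u, rfl⟩ := exists_offset_eq o (hj.2.trans hbounds.2)
    refine ⟨w, (h.mem_closedNbhd_singleton_iff hp hi).mpr hiv, ⟨p, hp, hi⟩, u, ⟨p, hp, hj⟩, ?_⟩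
    rw [cycleGraph_adj_iff_offset o (by omega)]
    omega

theorem insert_cons (h : IsRunList o X (p :: l)) {v : Fin n}
    (hleft : p.1 ≤ offset o v + 1) (hright : offset o v ≤ p.2) :
    IsRunList o (insert v X) ((p.1, offset o v - 1) :: (offset o v + 2, p.2) :: l) where
  notMem_closedNbhd_iff x := by
    have hfar : (∃ q ∈ p :: l, offset o x ∈ Set.Ico q.1 q.2) →
        (x ∉ closedNbhd (cycleGraph n) {v} ↔
          offset o v + 2 ≤ offset o x ∨ offset o x + 2 ≤ offset o v) := by
      rintro ⟨q, hq, hx⟩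
      rw [h.mem_closedNbhd_singleton_iff hq hx]
      omega
    have hother : (∃ q ∈ l, offset o x ∈ Set.Ico q.1 q.2) →
        offset o v + 2 ≤ offset o x ∨ offset o x + 2 ≤ offset o v := by
      rintro ⟨q, hq, hx⟩
      have hsep := List.rel_of_pairwise_cons h.separated hq
      rw [Set.mem_Ico] at hx
      unfold Separated at hsep
      omega
    rw [Finset.coe_insert, closedNbhd_insert, Set.mem_union, not_or, h.notMem_closedNbhd_iff]
    simp only [List.mem_cons, exists_eq_or_imp, Set.mem_Ico] at hfar hother ⊢
    have hbounds := h.bounds p List.mem_cons_self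
    grind
  bounds q hq := by
    have hp := h.bounds p List.mem_cons_self
    rcases List.mem_cons.mp hq with rfl | hq
    · exact ⟨hp.1, by omega⟩
    · rcases List.mem_cons.mp hq with rfl | hq
      · exact ⟨by omega, hp.2⟩
      · exact h.bounds q (List.mem_cons_of_mem _ hq)
  separated := by
    obtain ⟨hsep, hpairwise⟩ := List.pairwise_cons.mp h.separated
    simp only [List.pairwise_cons, List.forall_mem_cons, hpairwise, and_true]
    have hbounds := h.bounds p List.mem_cons_self
    unfold Separated at hsep ⊢
    refine ⟨⟨by omega, fun q hq ↦ ?_⟩, fun q hq ↦ ?_⟩ <;> have hpq := hsep q hq <;> omega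

end IsRunList

theorem RunSplit.exists_cut {a b : ℕ} (hp : 1 ≤ p.1) (h : RunSplit (p.2 - p.1) a b) :
    ∃ c, p.1 ≤ c + 1 ∧ c ≤ p.2 ∧ c - 1 - p.1 = a ∧ p.2 - (c + 2) = b := by
  obtain ⟨hr, hlt, hle, hthree | rfl | rfl⟩ := h
  · exact ⟨p.1 + a + 1, by omega⟩
  · exact ⟨p.2 - (b + 2), by omega⟩
  · exact ⟨p.1 + a + 1, by omega⟩

theorem runSplit_cut {c : ℕ} (hp : p.1 + 2 ≤ p.2) (hleft : p.1 ≤ c + 1) (hright : c ≤ p.2) :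
    RunSplit (p.2 - p.1) (c - 1 - p.1) (p.2 - (c + 2)) := by
  unfold RunSplit
  omega

theorem isRunModel_hasRuns (o : Fin n) : IsRunModel (cycleGraph n) (HasRuns o) where
  exists_runMove := by
    rintro X _ v ⟨l, hl, rfl⟩ hv
    obtain ⟨p, hp, hlen, hleft, hright⟩ := hl.mem_legalMoves_iff.mp hv
    have hperm := List.perm_cons_erase hp
    refine ⟨_, ?_, _, (hl.perm hperm).insert_cons hleft hright, rfl⟩
    simp only [Multiset.coe_eq_coe.mpr (hperm.map _), List.map_cons, ← Multiset.cons_coe]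
    exact (runSplit_cut hlen hleft hright).runMove _
  exists_legalMove := by
    rintro X _ _ ⟨l, hl, rfl⟩ ⟨t, r, a, b, hsplit, hs, rfl⟩
    obtain ⟨p, hp, rfl⟩ : ∃ p ∈ l, p.2 - p.1 = r := by
      rw [← List.mem_map, ← Multiset.mem_coe, hs]
      exact Multiset.mem_cons_self r t
    have hperm := List.perm_cons_erase hp
    obtain rfl : (((l.erase p).map fun p ↦ p.2 - p.1 : List ℕ) : Multiset ℕ) = t := by
      rwa [Multiset.coe_eq_coe.mpr (hperm.map _), List.map_cons, ← Multiset.cons_coe,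
        Multiset.cons_inj_right] at hs
    obtain ⟨c, hleft, hright, rfl, rfl⟩ := hsplit.exists_cut (hl.bounds p hp).1
    obtain ⟨v, rfl⟩ := exists_offset_eq o (hright.trans_lt (hl.bounds p hp).2)
    have hlen := hsplit.1
    exact ⟨v, hl.mem_legalMoves_iff.mpr ⟨p, hp, by omega, hleft, hright⟩, _,
      (hl.perm hperm).insert_cons hleft hright, rfl⟩

theorem hasRuns_singleton (hn : 2 ≤ n) (o : Fin n) : HasRuns o {o} {n - 3} := by
  refine ⟨[(2, n - 1)], ⟨fun x ↦ ?_, ?_, List.pairwise_singleton _ _⟩, ?_⟩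
  · have hx := offset_lt o x
    rw [Finset.coe_singleton, mem_closedNbhd_singleton, cycleGraph_adj_iff_offset o hn,
      ← offset_inj (o := o), offset_self]
    simp only [List.mem_singleton, exists_eq_left, Set.mem_Ico, true_and]
    omega
  · simp only [List.mem_singleton, forall_eq]
    exact ⟨by omega, by omega⟩
  · rfl

theorem mem_legalMoves_empty (hn : 2 ≤ n) (v : Fin n) : v ∈ legalMoves (cycleGraph n) ∅ := by
  obtain ⟨u, hu⟩ := exists_offset_eq v (show 1 < n by omega)
  have hadj : (cycleGraph n).Adj v u := by
    rw [cycleGraph_adj_iff_offset v hn, offset_self]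
    omega
  exact mem_legalMoves.mpr ⟨v, mem_closedNbhd_singleton.mpr (.inl rfl),
    inNontrivialComponent_iff.mpr ⟨by simp [closedNbhd], u, by simp [closedNbhd], hadj⟩⟩

theorem gameIsolationNumber_cycleGraph (hn : 2 ≤ n) :
    gameIsolationNumber (cycleGraph n) = n / 5 + (n + 4) / 5 := by
  obtain ⟨v, -, hopt⟩ := exists_movesLeft_dominator_eq
    ⟨⟨0, by omega⟩, mem_legalMoves_empty hn _⟩
  rw [gameIsolationNumber, hopt, insert_empty_eq,
    (isRunModel_hasRuns v).movesLeft_staller_singleton (hasRuns_singleton hn v)]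
  omega

theorem stallerStartGameIsolationNumber_cycleGraph (hn : 4 ≤ n) :
    stallerStartGameIsolationNumber (cycleGraph n) = n / 5 + (n + 1) / 5 := by
  obtain ⟨v, -, hopt⟩ := exists_movesLeft_staller_eq
    ⟨⟨0, by omega⟩, mem_legalMoves_empty (show 2 ≤ n by omega) _⟩
  rw [stallerStartGameIsolationNumber, hopt, insert_empty_eq,
    (isRunModel_hasRuns v).movesLeft_dominator_singleton (hasRuns_singleton (by omega) v)]
  omega

end Cycle

end IsolationGame

theorem theorem2p3 (n : ℕ) (hn : 4 ≤ n) :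
    (IsolationGame.gameIsolationNumber (SimpleGraph.cycleGraph n) : ℤ) =
        (if n ≡ 0 [MOD 5] then 2 * ⌈(n : ℚ) / 5⌉ else 2 * ⌈(n : ℚ) / 5⌉ - 1) ∧
      (IsolationGame.stallerStartGameIsolationNumber (SimpleGraph.cycleGraph n) : ℤ) =
        (if n ≡ 4 [MOD 5] then 2 * ⌊(n : ℚ) / 5⌋ + 1 else 2 * ⌊(n : ℚ) / 5⌋) := by
  have hfloor := Rat.floor_natCast_div_natCast n 5
  have hceil := Rat.ceil_natCast_div_natCast n 5
  push_cast at hfloor hceil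
  rw [IsolationGame.gameIsolationNumber_cycleGraph (by omega),
    IsolationGame.stallerStartGameIsolationNumber_cycleGraph hn, hfloor, hceil]
  unfold Nat.ModEq
  constructor <;> split_ifs <;> omega
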